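/- All graphs are finite and simple, $\lambda(G)$ denotes the spectral radius of $G$, that is, the maximum modulus of the eigenvalues of its adjacency matrix, and equality of graphs is understood up to isomorphism. For integers $m\ge 2$ and $q\ge 1$, let $T_{m,2}$ be the complete bipartite graph on $m$ vertices with partite sets of sizes $\lfloor m/2\rfloor$ and $\lceil m/2\rceil$, and let $T_{m,2}\circ K_q$ be the $(m+q-1)$-vertex graph obtained by identifying a vertex of the complete graph $K_q$ with a vertex of a partite set of size $\lfloor m/2\rfloor$ of $T_{m,2}$. Let $\mathcal G^*_{n,r}$ be the family of $n$-vertex graphs $G$ that are obtained from a bipartite graph $B$ by suspending graphs $G_1,\dots,G_s$ for some $s\in\mathbb N$, with $\sum_{i=1}^s|V(G_i)\setminus V(B)|=r-2$; that is, $G$ is the union of its subgraphs $B,G_1,\dots,G_s$, where $B$ is bipartite, each $G_i$ has exactly one vertex in common with $B$, and distinct $G_i,G_j$ have no common vertex outside $B$. Let $n,k,r$ be integers with $n\ge 100k$ and $3\le r\le 10k$. (1) We have $T_{n-r+2,2}\circ K_{r-1}\in\mathcal G^*_{n,r}$, and every $G\in\mathcal G^*_{n,r}$ satisfies $$\lambda(G)\le\lambda(T_{n-r+2,2}\circ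 K_{r-1}),$$ with equality if and only if $G=T_{n-r+2,2}\circ K_{r-1}$. (2) For every integer $s$ with $r<s\le 10k$, $$\lambda(T_{n-s+2,2}\circ K_{s-1})<\lambda(T_{n-r+2,2}\circ K_{r-1}).$$ -/

import Mathlib

open scoped ENNReal

namespace SpectralSuspension

open Classical in
/-- The spectral radius `λ(G)` of a finite graph: the maximum modulus of the eigenvalues of its
adjacency matrix. That matrix is real symmetric, so its eigenvalues are all real. -/
noncomputable def specRad {V : Type*} [Fintype V] (G : SimpleGraph V) : ℝ≥0∞ :=
  spectralRadius ℝ (G.adjMatrix ℝ)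

/-- The graph obtained from the disjoint union of `G` and `H` by identifying the vertex `u` of `G`
with the vertex `v` of `H`; the identified vertex is `Sum.inl u`. -/
def identify {V W : Type*} (G : SimpleGraph V) (u : V) (H : SimpleGraph W) (v : W) :
    SimpleGraph (V ⊕ {w : W // w ≠ v}) where
  Adj
    | .inl x, .inl y => G.Adj x y
    | .inl x, .inr w => x = u ∧ H.Adj v w
    | .inr w, .inl x => x = u ∧ H.Adj v w
    | .inr w, .inr z => H.Adj w z
  symm := ⟨by
    rintro (x | w) (y | z) h
    · exact G.adj_symm h
    · exact h
    · exact h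
    · exact H.adj_symm h⟩
  loopless := ⟨by
    rintro (x | w) h
    · exact G.loopless.irrefl x h
    · exact H.loopless.irrefl _ h⟩

/-- The graph `T_{m,2} ∘ K_q`: a vertex of the complete graph `K_q` is identified with a vertex of
the smaller partite set of the bipartite Turán graph `T_{m,2}`. In `SimpleGraph.turanGraph m 2` the
partite sets are the even and the odd elements of `{0, …, m - 1}`, of sizes `⌈m/2⌉` and `⌊m/2⌋`;
so the vertex `1` lies in the one of size `⌊m/2⌋`. -/
def turanCircClique (m q : ℕ) (hm : 2 ≤ m) (hq : 1 ≤ q) :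
    SimpleGraph (Fin m ⊕ {w : Fin q // w ≠ ⟨0, hq⟩}) :=
  identify (SimpleGraph.turanGraph m 2) ⟨1, hm⟩ (⊤ : SimpleGraph (Fin q)) ⟨0, hq⟩

/-- `G` is an `n`-vertex graph obtained from a bipartite graph `B` by suspending graphs
`H 0, …, H (s - 1)`, with exactly `r - 2` vertices outside `B`. Each `H i` meets `B` in exactly one
vertex, different `H i` have no common vertex outside `B`, and `G` is the union of `B` and the
`H i`. -/
def IsBipartiteSuspension {V : Type*} [Fintype V] (n r : ℕ) (G : SimpleGraph V) : Prop :=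
  Fintype.card V = n ∧
  ∃ (B : G.Subgraph) (s : ℕ) (H : Fin s → G.Subgraph),
    B.coe.IsBipartite ∧
    (∀ i, ∃ v, (H i).verts ∩ B.verts = {v}) ∧
    (∀ i j, i ≠ j → (H i).verts ∩ (H j).verts ⊆ B.verts) ∧
    B ⊔ (⨆ i, H i) = ⊤ ∧
    (∑ i, ((H i).verts \ B.verts).ncard) + 2 = r

end SpectralSuspension

/-!
Every graph `G` of the family lies in a graph `cliqueSuspension π col`, in which cliques are
suspended from a complete bipartite core. Let `x v` be the number of vertices outside the core of
the clique at the core vertex `v`. Eliminating these vertices from the eigenvalue equation for `t`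
multiplies the entry of an eigenvector at `v` by `1 + gain t (x v)`. What remains is the equation of
a complete bipartite graph whose classes, of sizes `a` and `b`, have weights `a + f₁` and `b + f₂`,
where `f₁` and `f₂` are the total gains. So `t` is the spectral radius when
`(a + f₁) * (b + f₂) = t ^ 2`, and an upper bound for it when `≤` holds, because the eigenvector is
positive.

It remains to maximise the product when `a + b` and the sum `p` of all `x v` are fixed. The gain is
superadditive with room to spare, `f₁ + f₂ + 2 * (f₁ * f₂) ≤ gain t p`, and `gain t p < 1`. Hence
the product is at most `⌈(a + b) / 2⌉ * (⌊(a + b) / 2⌋ + gain t p)`, attained only if the classes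
are balanced and a single clique, suspended at the class of size `⌊(a + b) / 2⌋`, contains all
vertices outside the core. Since `gain t p < 1`, moving a vertex from the clique to the core
increases the product.
-/

namespace SpectralSuspension

section NonnegativeSymmetricMatrix

open Matrix

variable {ι : Type*} [Fintype ι]

lemma mem_spectrum_iff_exists_mulVec_eq_smul {K : Type*} [Field K] [DecidableEq ι]
    (A : Matrix ι ι K) (t : K) : t ∈ spectrum K A ↔ ∃ x ≠ 0, A *ᵥ x = t • x := by
  rw [← Matrix.spectrum_toLin', ← Module.End.hasEigenvalue_iff_mem_spectrum]
  constructor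
  · intro h
    obtain ⟨x, hx⟩ := h.exists_hasEigenvector
    exact ⟨x, hx.2, by simpa using hx.apply_eq_smul⟩
  · rintro ⟨x, hx, h⟩
    exact Module.End.hasEigenvalue_of_hasEigenvector
      ⟨Module.End.mem_eigenspace_iff.2 (by simpa using h), hx⟩

lemma mulVec_mono {A B : Matrix ι ι ℝ} (h : ∀ i j, A i j ≤ B i j) {x : ι → ℝ} (hx : 0 ≤ x) :
    A *ᵥ x ≤ B *ᵥ x :=
  fun i ↦ dotProduct_le_dotProduct_of_nonneg_right (h i) hx

lemma smul_abs_le_mulVec_abs {A : Matrix ι ι ℝ} (hA : ∀ i j, 0 ≤ A i j) {x : ι → ℝ} {t : ℝ}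
    (h : A *ᵥ x = t • x) : |t| • |x| ≤ A *ᵥ |x| := by
  intro i
  calc (|t| • |x|) i = |∑ j, A i j * x j| := by
        rw [Pi.smul_apply, Pi.abs_apply, smul_eq_mul, ← abs_mul]
        exact congrArg abs (congrFun h i).symm
    _ ≤ ∑ j, |A i j * x j| := Finset.abs_sum_le_sum_abs _ _
    _ = (A *ᵥ |x|) i := Finset.sum_congr rfl fun j _ ↦ by
        rw [abs_mul, abs_of_nonneg (hA i j), Pi.abs_apply]

lemma exists_abs_smul_le_mulVec_of_mem_spectrum [DecidableEq ι] {A : Matrix ι ι ℝ}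
    (hA : ∀ i j, 0 ≤ A i j) {t : ℝ} (ht : t ∈ spectrum ℝ A) :
    ∃ z ≠ 0, 0 ≤ z ∧ |t| • z ≤ A *ᵥ z := by
  obtain ⟨x, hx, hAx⟩ := (mem_spectrum_iff_exists_mulVec_eq_smul A t).1 ht
  have hx' : |x| ≠ 0 := fun h ↦ hx (funext fun i ↦ abs_eq_zero.1 (congrFun h i))
  exact ⟨|x|, hx', abs_nonneg x, smul_abs_le_mulVec_abs hA hAx⟩

lemma dotProduct_mulVec_comm {A : Matrix ι ι ℝ} (hA : A.IsSymm) (x y : ι → ℝ) :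
    x ⬝ᵥ A *ᵥ y = y ⬝ᵥ A *ᵥ x := by
  rw [dotProduct_mulVec, ← mulVec_transpose, hA.eq, dotProduct_comm]

lemma eq_of_dotProduct_eq {y u v : ι → ℝ} (hy : ∀ i, 0 < y i) (huv : u ≤ v)
    (h : y ⬝ᵥ u = y ⬝ᵥ v) : u = v := by
  have hterm := (Finset.sum_eq_sum_iff_of_le fun i _ ↦
    mul_le_mul_of_nonneg_left (huv i) (hy i).le).1 h
  exact funext fun i ↦ mul_left_cancel₀ (hy i).ne' (hterm i (Finset.mem_univ i))

lemma ofReal_le_spectralRadius [DecidableEq ι] {A : Matrix ι ι ℝ} {x : ι → ℝ} (hx : x ≠ 0)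
    {t : ℝ} (h : A *ᵥ x = t • x) : ENNReal.ofReal t ≤ spectralRadius ℝ A :=
  calc ENNReal.ofReal t ≤ ‖t‖ₑ := by
        rw [Real.enorm_eq_ofReal_abs]
        exact ENNReal.ofReal_le_ofReal (le_abs_self t)
    _ ≤ spectralRadius ℝ A :=
        le_iSup₂_of_le t ((mem_spectrum_iff_exists_mulVec_eq_smul A t).2 ⟨x, hx, h⟩) le_rfl

lemma exists_mem_spectrum_enorm_eq_spectralRadius [DecidableEq ι] [Nonempty ι]
    {A : Matrix ι ι ℝ} (hA : A.IsHermitian) :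
    ∃ t ∈ spectrum ℝ A, ‖t‖ₑ = spectralRadius ℝ A := by
  obtain ⟨i, hi⟩ := exists_eq_ciSup_of_finite (f := fun i ↦ ‖hA.eigenvalues i‖ₑ)
  refine ⟨hA.eigenvalues i, hA.eigenvalues_mem_spectrum_real i, hi.trans ?_⟩
  rw [spectralRadius, hA.spectrum_real_eq_range_eigenvalues, iSup_range]
  rfl

lemma exists_smul_le_mulVec_of_spectralRadius_eq [DecidableEq ι] [Nonempty ι] {A : Matrix ι ι ℝ}
    (hA : A.IsSymm) (hnonneg : ∀ i j, 0 ≤ A i j) {t : ℝ} (ht : 0 ≤ t)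
    (h : spectralRadius ℝ A = ENNReal.ofReal t) :
    ∃ z ≠ 0, 0 ≤ z ∧ t • z ≤ A *ᵥ z := by
  obtain ⟨s, hs, hst⟩ := exists_mem_spectrum_enorm_eq_spectralRadius (A := A)
    (by rwa [IsHermitian, conjTranspose_eq_transpose_of_trivial])
  rw [h, Real.enorm_eq_ofReal_abs, ENNReal.ofReal_eq_ofReal_iff (abs_nonneg s) ht] at hst
  exact hst ▸ exists_abs_smul_le_mulVec_of_mem_spectrum hnonneg hs

lemma le_of_smul_le_mulVec {A : Matrix ι ι ℝ} (hA : A.IsSymm) {y z : ι → ℝ} {s t : ℝ}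
    (hy : ∀ i, 0 < y i) (hAy : A *ᵥ y ≤ t • y) (hz₀ : z ≠ 0) (hz : 0 ≤ z)
    (hAz : s • z ≤ A *ᵥ z) : s ≤ t := by
  have hyz : 0 < y ⬝ᵥ z := by
    obtain ⟨i, hi⟩ := Function.ne_iff.1 hz₀
    exact Finset.sum_pos' (fun j _ ↦ mul_nonneg (hy j).le (hz j))
      ⟨i, Finset.mem_univ i, mul_pos (hy i) ((hz i).lt_of_ne' hi)⟩
  refine le_of_mul_le_mul_right ?_ hyz
  calc s * (y ⬝ᵥ z) = y ⬝ᵥ s • z := by rw [dotProduct_smul, smul_eq_mul]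
    _ ≤ y ⬝ᵥ A *ᵥ z := dotProduct_le_dotProduct_of_nonneg_left hAz fun i ↦ (hy i).le
    _ = z ⬝ᵥ A *ᵥ y := dotProduct_mulVec_comm hA y z
    _ ≤ z ⬝ᵥ t • y := dotProduct_le_dotProduct_of_nonneg_left hAy hz
    _ = t * (y ⬝ᵥ z) := by rw [dotProduct_smul, smul_eq_mul, dotProduct_comm]

lemma mulVec_eq_smul_of_smul_le_mulVec {A : Matrix ι ι ℝ} (hA : A.IsSymm) {y z : ι → ℝ} {t : ℝ}
    (hy : ∀ i, 0 < y i) (hAy : A *ᵥ y ≤ t • y) (hz : 0 ≤ z) (hAz : t • z ≤ A *ᵥ z) :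
    A *ᵥ z = t • z := by
  refine (eq_of_dotProduct_eq hy hAz (le_antisymm ?_ ?_)).symm
  · exact dotProduct_le_dotProduct_of_nonneg_left hAz fun i ↦ (hy i).le
  · calc y ⬝ᵥ A *ᵥ z = z ⬝ᵥ A *ᵥ y := dotProduct_mulVec_comm hA y z
      _ ≤ z ⬝ᵥ t • y := dotProduct_le_dotProduct_of_nonneg_left hAy hz
      _ = y ⬝ᵥ t • z := by rw [dotProduct_smul, dotProduct_smul, dotProduct_comm]

end NonnegativeSymmetricMatrix

section Graph

open Matrix SimpleGraph

variable {V : Type*}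

lemma adjMatrix_nonneg (G : SimpleGraph V) [DecidableRel G.Adj] (v w : V) :
    0 ≤ G.adjMatrix ℝ v w := by
  rw [adjMatrix_apply]
  positivity

lemma adjMatrix_mono {G H : SimpleGraph V} [DecidableRel G.Adj] [DecidableRel H.Adj]
    (h : G ≤ H) (v w : V) : G.adjMatrix ℝ v w ≤ H.adjMatrix ℝ v w := by
  simp only [adjMatrix_apply]
  split_ifs with hG hH
  · rfl
  · exact absurd (h hG) hH
  · exact zero_le_one
  · rfl

variable [Fintype V]

lemma specRad_eq_spectralRadius [DecidableEq V] (G : SimpleGraph V) [DecidableRel G.Adj] :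
    specRad G = spectralRadius ℝ (G.adjMatrix ℝ) := by
  unfold specRad
  congr!

lemma specRad_congr {W : Type*} [Fintype W] {G : SimpleGraph V} {H : SimpleGraph W} (e : G ≃g H) :
    specRad G = specRad H := by
  classical
  rw [specRad_eq_spectralRadius, specRad_eq_spectralRadius, ← e.reindex_adjMatrix ℝ,
    ← coe_reindexAlgEquiv ℝ ℝ]
  simp only [spectralRadius, AlgEquiv.spectrum_eq]

lemma specRad_le_of_mulVec_le {G H : SimpleGraph V} [DecidableRel H.Adj] (hGH : G ≤ H) {y : V → ℝ}
    (hy : ∀ v, 0 < y v) {t : ℝ} (hHy : H.adjMatrix ℝ *ᵥ y ≤ t • y) :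
    specRad G ≤ ENNReal.ofReal t := by
  classical
  rw [specRad_eq_spectralRadius]
  refine iSup₂_le fun s hs ↦ ?_
  obtain ⟨z, hz₀, hz, hGz⟩ := exists_abs_smul_le_mulVec_of_mem_spectrum (adjMatrix_nonneg G) hs
  have hGy : G.adjMatrix ℝ *ᵥ y ≤ t • y :=
    (mulVec_mono (adjMatrix_mono hGH) fun v ↦ (hy v).le).trans hHy
  rw [← enorm_eq_nnnorm, Real.enorm_eq_ofReal_abs]
  exact ENNReal.ofReal_le_ofReal (le_of_smul_le_mulVec (isSymm_adjMatrix G) hy hGy hz₀ hz hGz)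

lemma pos_of_adjMatrix_mulVec_eq_smul {G : SimpleGraph V} [DecidableRel G.Adj]
    (hG : G.Preconnected) {z : V → ℝ} (hz₀ : z ≠ 0) (hz : 0 ≤ z) {t : ℝ}
    (hGz : G.adjMatrix ℝ *ᵥ z = t • z) (v : V) : 0 < z v := by
  have hzero : ∀ u, z u = 0 → ∀ w, G.Adj u w → z w = 0 := fun u hu w huw ↦ by
    have hsum : ∑ x ∈ G.neighborFinset u, z x = 0 := by
      simpa [hu] using congrFun hGz u
    exact (Finset.sum_eq_zero_iff_of_nonneg fun x _ ↦ hz x).1 hsum w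
      ((G.mem_neighborFinset u w).2 huw)
  refine (hz v).lt_of_ne' fun hv ↦ hz₀ (funext fun w ↦ ?_)
  obtain ⟨p⟩ := hG v w
  induction p with
  | nil => exact hv
  | cons h _ ih => exact ih (hzero _ hv _ h)

lemma eq_of_adjMatrix_mulVec_eq {G H : SimpleGraph V} [DecidableRel G.Adj] [DecidableRel H.Adj]
    (hGH : G ≤ H) {z : V → ℝ} (hz : ∀ v, 0 < z v)
    (h : G.adjMatrix ℝ *ᵥ z = H.adjMatrix ℝ *ᵥ z) : G = H := by
  refine le_antisymm hGH fun v w hvw ↦ ?_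
  have hrow : G.adjMatrix ℝ v = H.adjMatrix ℝ v :=
    eq_of_dotProduct_eq hz (adjMatrix_mono hGH v) <| by
      rw [dotProduct_comm z, dotProduct_comm z]
      exact congrFun h v
  simpa [hvw] using congrFun hrow w

lemma eq_and_mulVec_eq_of_specRad_eq {G H : SimpleGraph V} [DecidableRel H.Adj] (hGH : G ≤ H)
    (hH : H.Connected) {y : V → ℝ} (hy : ∀ v, 0 < y v) {t : ℝ} (ht : 0 ≤ t)
    (hHy : H.adjMatrix ℝ *ᵥ y ≤ t • y) (h : specRad G = ENNReal.ofReal t) :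
    G = H ∧ H.adjMatrix ℝ *ᵥ y = t • y := by
  classical
  have := hH.nonempty
  obtain ⟨z, hz₀, hz, hGz⟩ := exists_smul_le_mulVec_of_spectralRadius_eq (isSymm_adjMatrix G)
    (adjMatrix_nonneg G) ht (specRad_eq_spectralRadius G ▸ h)
  have hGHz : G.adjMatrix ℝ *ᵥ z ≤ H.adjMatrix ℝ *ᵥ z := mulVec_mono (adjMatrix_mono hGH) hz
  have hHz := mulVec_eq_smul_of_smul_le_mulVec (isSymm_adjMatrix H) hy hHy hz (hGz.trans hGHz)
  have hz_pos := pos_of_adjMatrix_mulVec_eq_smul hH.preconnected hz₀ hz hHz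
  refine ⟨eq_of_adjMatrix_mulVec_eq hGH hz_pos (le_antisymm hGHz (hHz.trans_le hGz)),
    eq_of_dotProduct_eq hz_pos hHy ?_⟩
  rw [dotProduct_mulVec_comm (isSymm_adjMatrix H), hHz, dotProduct_smul, dotProduct_smul,
    dotProduct_comm]

end Graph

section CliqueSuspension

open Finset Matrix

variable {V : Type*}

/-- The edge-maximal graph in which cliques are suspended from a bipartite graph: `π` is thought of
as a retraction of the vertices onto the core, whose two classes are given by `col`. The fibres
of `π` are cliques, and the core is complete bipartite. -/
def cliqueSuspension (π : V → V) (col : V → Bool) : SimpleGraph V where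
  Adj v w := v ≠ w ∧ (π v = π w ∨ (π v = v ∧ π w = w ∧ col v ≠ col w))
  symm := ⟨fun _ _ h ↦ ⟨h.1.symm, h.2.imp Eq.symm fun h' ↦ ⟨h'.2.1, h'.1, h'.2.2.symm⟩⟩⟩
  loopless := ⟨fun _ h ↦ h.1 rfl⟩

lemma cliqueSuspension_adj {π : V → V} {col : V → Bool} {v w : V} :
    (cliqueSuspension π col).Adj v w ↔
      v ≠ w ∧ (π v = π w ∨ (π v = v ∧ π w = w ∧ col v ≠ col w)) :=
  Iff.rfl

lemma cliqueSuspension_not (π : V → V) (col : V → Bool) :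
    cliqueSuspension π (fun v ↦ !col v) = cliqueSuspension π col := by
  ext v w
  simp [cliqueSuspension_adj]

instance [DecidableEq V] (π : V → V) (col : V → Bool) :
    DecidableRel (cliqueSuspension π col).Adj :=
  fun v w ↦ inferInstanceAs (Decidable (v ≠ w ∧ _))

variable [Fintype V] [DecidableEq V] {π : V → V} {col : V → Bool} {t : ℝ}

/-- The class of colour `c` of the core of `cliqueSuspension π col`. -/
def coreClass (π : V → V) (col : V → Bool) (c : Bool) : Finset V :=
  {v | π v = v ∧ col v = c}

/-- The number of vertices outside the core of the clique suspended at the core vertex `v`. -/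
def fiberExcess (π : V → V) (v : V) : ℕ :=
  #{w | π w = v ∧ w ≠ v}

/-- Suspending a clique with `x` further vertices at a core vertex multiplies the entry of an
eigenvector for `t` at that vertex by `1 + gain t x`. -/
noncomputable def gain (t x : ℝ) : ℝ := x / ((t + 1) * (t - x))

/-- The total gain of the cliques suspended at one class of the core. -/
noncomputable def classGain (π : V → V) (col : V → Bool) (t : ℝ) (c : Bool) : ℝ :=
  ∑ v ∈ coreClass π col c, gain t (fiberExcess π v)

/-- The size of one class of the core, increased by its gain. The number `t` is the spectral radius
of `cliqueSuspension π col` when the product of the weights of the two classes is `t ^ 2`. -/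
noncomputable def classWeight (π : V → V) (col : V → Bool) (t : ℝ) (c : Bool) : ℝ :=
  #(coreClass π col c) + classGain π col t c

/-- A candidate for an eigenvector of `cliqueSuspension π col` for `t`: the eigenvalue equation
holds outside the core, and `α c` is the sum of the entries that it prescribes on the neighbours in
the core of a core vertex of colour `c`. -/
noncomputable def testVector (π : V → V) (col : V → Bool) (t : ℝ) (α : Bool → ℝ) (v : V) : ℝ :=
  α (col (π v)) / (t + 1) * ((if π v = v then 1 else 0) + 1 / (t - fiberExcess π (π v)))

@[simp]
lemma mem_coreClass {c : Bool} {v : V} : v ∈ coreClass π col c ↔ π v = v ∧ col v = c := by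
  simp [coreClass]

lemma coreClass_not (π : V → V) (col : V → Bool) (c : Bool) :
    coreClass π (fun v ↦ !col v) c = coreClass π col !c := by
  ext v
  simp [Bool.not_eq_eq_eq_not]

lemma gain_nonneg {x : ℝ} (hx : 0 ≤ x) (hxt : x < t) : 0 ≤ gain t x :=
  div_nonneg hx (mul_nonneg (by linarith) (by linarith))

lemma classGain_nonneg (hx : ∀ v, (fiberExcess π v : ℝ) < t) (c : Bool) :
    0 ≤ classGain π col t c :=
  sum_nonneg fun v _ ↦ gain_nonneg (Nat.cast_nonneg _) (hx v)

lemma classWeight_pos (hx : ∀ v, (fiberExcess π v : ℝ) < t) {c : Bool}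
    (hc : (coreClass π col c).Nonempty) : 0 < classWeight π col t c :=
  add_pos_of_pos_of_nonneg (Nat.cast_pos.2 hc.card_pos) (classGain_nonneg hx c)

lemma testVector_pos (ht : 0 < t) (hx : ∀ v, (fiberExcess π v : ℝ) < t) {α : Bool → ℝ}
    (hα : ∀ c, 0 < α c) (v : V) : 0 < testVector π col t α v := by
  have hden : 0 < t - fiberExcess π (π v) := sub_pos.2 (hx _)
  have := hα (col (π v))
  unfold testVector
  positivity

lemma card_fiber {v : V} (hv : π v = v) : #{w | π w = v} = fiberExcess π v + 1 := by
  rw [fiberExcess, filter_and_not, filter_eq', if_pos (mem_univ v), sdiff_singleton_eq_erase,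
    card_erase_add_one (by simpa using hv)]

lemma sum_fiber_testVector (ht : 0 < t) {v : V} (hv : π v = v) (hx : (fiberExcess π v : ℝ) < t)
    (α : Bool → ℝ) :
    ∑ w with π w = v, testVector π col t α w = α (col v) / (t - fiberExcess π v) := by
  have hcore : ∑ w with π w = v, (if v = w then 1 else 0 : ℝ) = 1 := by
    rw [sum_ite_eq, if_pos (by simpa using hv)]
  have hden : t - fiberExcess π v ≠ 0 := (sub_pos.2 hx).ne'
  calc ∑ w with π w = v, testVector π col t α w
      = ∑ w with π w = v, α (col v) / (t + 1) *
          ((if v = w then 1 else 0) + 1 / (t - fiberExcess π v)) :=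
        sum_congr rfl fun w hw ↦ by rw [testVector, (mem_filter.1 hw).2]
    _ = α (col v) / (t + 1) * (1 + (fiberExcess π v + 1) * (1 / (t - fiberExcess π v))) := by
        rw [← mul_sum, sum_add_distrib, hcore, sum_const, card_fiber hv, nsmul_eq_mul]
        push_cast
        rfl
    _ = α (col v) / (t - fiberExcess π v) := by
        field_simp
        ring

lemma testVector_of_apply_eq (ht : 0 < t) {v : V} (hv : π v = v)
    (hx : (fiberExcess π v : ℝ) < t) (α : Bool → ℝ) :
    testVector π col t α v = α (col v) / t * (1 + gain t (fiberExcess π v)) := by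
  have hden : t - fiberExcess π v ≠ 0 := (sub_pos.2 hx).ne'
  rw [testVector, hv, if_pos rfl, gain]
  field_simp
  ring

lemma sum_coreClass_testVector (ht : 0 < t) (hx : ∀ v, (fiberExcess π v : ℝ) < t) (α : Bool → ℝ)
    (c : Bool) :
    ∑ v ∈ coreClass π col c, testVector π col t α v = α c / t * classWeight π col t c :=
  calc ∑ v ∈ coreClass π col c, testVector π col t α v
      = ∑ v ∈ coreClass π col c, α c / t * (1 + gain t (fiberExcess π v)) :=
        sum_congr rfl fun v hv ↦ by
          obtain ⟨hcore, rfl⟩ := mem_coreClass.1 hv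
          exact testVector_of_apply_eq ht hcore (hx v) α
    _ = α c / t * classWeight π col t c := by
        rw [← mul_sum, sum_add_distrib, sum_const, nsmul_one, classWeight, classGain]

lemma adjMatrix_cliqueSuspension_mulVec_add (x : V → ℝ) (v : V) :
    ((cliqueSuspension π col).adjMatrix ℝ *ᵥ x) v + x v =
      ∑ w with π w = π v, x w + if π v = v then ∑ w ∈ coreClass π col (!col v), x w else 0 := by
  rw [SimpleGraph.adjMatrix_mulVec_apply, add_comm,
    ← sum_insert (SimpleGraph.notMem_neighborFinset_self _ v)]
  split_ifs with hv
  · have hdisj : Disjoint ({w | π w = π v} : Finset V) (coreClass π col (!col v)) := by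
      refine disjoint_left.2 fun w hw hw' ↦ ?_
      obtain ⟨hw₁, hw₂⟩ := mem_coreClass.1 hw'
      obtain rfl : w = v := by rw [← hw₁, (mem_filter.1 hw).2, hv]
      exact Bool.not_ne_self _ hw₂.symm
    rw [← sum_union hdisj]
    congr 1
    ext w
    by_cases hvw : v = w
    · simp [hvw]
    · simp [cliqueSuspension_adj, hvw, Ne.symm hvw, hv, eq_comm, Bool.eq_not]
  · rw [add_zero]
    congr 1
    ext w
    by_cases hvw : v = w
    · simp [hvw]
    · simp [cliqueSuspension_adj, hvw, Ne.symm hvw, hv, eq_comm]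

lemma adjMatrix_cliqueSuspension_mulVec_testVector (hπ : ∀ v, π (π v) = π v) (ht : 0 < t)
    (hx : ∀ v, (fiberExcess π v : ℝ) < t) (α : Bool → ℝ) (v : V) :
    ((cliqueSuspension π col).adjMatrix ℝ *ᵥ testVector π col t α) v =
      t * testVector π col t α v +
        if π v = v then α (!col v) / t * classWeight π col t (!col v) - α (col v) else 0 := by
  have hsum := adjMatrix_cliqueSuspension_mulVec_add (π := π) (col := col) (testVector π col t α) v
  rw [sum_fiber_testVector ht (hπ v) (hx _), sum_coreClass_testVector ht hx] at hsum
  have hvec : (t + 1) * testVector π col t α v =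
      α (col (π v)) * (if π v = v then 1 else 0) + α (col (π v)) / (t - fiberExcess π (π v)) := by
    rw [testVector]
    field_simp
  split_ifs at hsum hvec ⊢ with hv
  · rw [hv] at hsum hvec
    linarith
  · linarith

lemma exists_pos_mulVec_le (hπ : ∀ v, π (π v) = π v) (ht : 0 < t)
    (hx : ∀ v, (fiberExcess π v : ℝ) < t) (hc : ∀ c, (coreClass π col c).Nonempty)
    (hW : classWeight π col t true * classWeight π col t false ≤ t ^ 2) :
    ∃ y : V → ℝ, (∀ v, 0 < y v) ∧ (cliqueSuspension π col).adjMatrix ℝ *ᵥ y ≤ t • y ∧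
      ((cliqueSuspension π col).adjMatrix ℝ *ᵥ y = t • y ↔
        classWeight π col t true * classWeight π col t false = t ^ 2) := by
  let α : Bool → ℝ := fun c ↦ if c then classWeight π col t false else t
  set y := testVector π col t α with hy
  set δ := classWeight π col t true * classWeight π col t false - t ^ 2 with hδ
  have hα : ∀ c, 0 < α c := by
    rintro (_ | _)
    exacts [ht, classWeight_pos hx (hc false)]
  have hAy : (cliqueSuspension π col).adjMatrix ℝ *ᵥ y =
      t • y + fun v ↦ if v ∈ coreClass π col false then δ / t else 0 := by
    funext v
    rw [hy, adjMatrix_cliqueSuspension_mulVec_testVector hπ ht hx, Pi.add_apply, Pi.smul_apply,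
      smul_eq_mul]
    congr 1
    by_cases hv : π v = v
    · cases hcol : col v
      · simp only [hv, hcol, mem_coreClass, Bool.not_false, if_true, and_self, α, δ,
          Bool.false_eq_true, if_false]
        field_simp
      · simp [α, hv, hcol, ht.ne']
    · simp [hv]
  refine ⟨y, testVector_pos ht hx hα, ?_, ?_, fun h ↦ ?_⟩
  · rw [hAy]
    refine add_le_of_nonpos_right fun v ↦ ?_
    dsimp only
    split_ifs
    · exact div_nonpos_of_nonpos_of_nonneg (sub_nonpos.2 hW) ht.le
    · exact le_rfl
  · intro h
    obtain ⟨v, hv⟩ := hc false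
    have hzero := congrFun (add_eq_left.1 (hAy.symm.trans h)) v
    rw [if_pos hv] at hzero
    exact sub_eq_zero.1 ((div_eq_zero_iff.1 hzero).resolve_right ht.ne')
  · rw [hAy, hδ, h]
    ext v
    simp

lemma cliqueSuspension_connected (hπ : ∀ v, π (π v) = π v)
    (hc : ∀ c, (coreClass π col c).Nonempty) : (cliqueSuspension π col).Connected := by
  have hfiber : ∀ v, (cliqueSuspension π col).Reachable (π v) v := fun v ↦ by
    by_cases hv : π v = v
    · rw [hv]
    · exact SimpleGraph.Adj.reachable ⟨hv, Or.inl (hπ v)⟩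
  have hcore : ∀ v w, π v = v → π w = w → col v ≠ col w →
      (cliqueSuspension π col).Reachable v w := fun v w hv hw h ↦
    SimpleGraph.Adj.reachable ⟨fun hvw ↦ h (congrArg col hvw), Or.inr ⟨hv, hw, h⟩⟩
  obtain ⟨a, ha⟩ := hc true
  obtain ⟨b, hb⟩ := hc false
  rw [mem_coreClass] at ha hb
  refine SimpleGraph.connected_iff_exists_forall_reachable _ |>.2 ⟨a, fun v ↦ .trans ?_ (hfiber v)⟩
  cases hv : col (π v)
  · exact hcore _ _ ha.1 (hπ v) (by simp [ha.2, hv])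
  · exact (hcore _ _ ha.1 hb.1 (by simp [ha.2, hb.2])).trans
      (hcore _ _ hb.1 (hπ v) (by simp [hb.2, hv]))

lemma specRad_le_of_le_cliqueSuspension (hπ : ∀ v, π (π v) = π v) (ht : 0 < t)
    (hx : ∀ v, (fiberExcess π v : ℝ) < t) (hc : ∀ c, (coreClass π col c).Nonempty)
    (hW : classWeight π col t true * classWeight π col t false ≤ t ^ 2)
    {G : SimpleGraph V} (hG : G ≤ cliqueSuspension π col) : specRad G ≤ ENNReal.ofReal t := by
  obtain ⟨y, hy, hle, -⟩ := exists_pos_mulVec_le hπ ht hx hc hW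
  exact specRad_le_of_mulVec_le hG hy hle

lemma specRad_cliqueSuspension_eq (hπ : ∀ v, π (π v) = π v) (ht : 0 < t)
    (hx : ∀ v, (fiberExcess π v : ℝ) < t) (hc : ∀ c, (coreClass π col c).Nonempty)
    (hW : classWeight π col t true * classWeight π col t false = t ^ 2) :
    specRad (cliqueSuspension π col) = ENNReal.ofReal t := by
  obtain ⟨y, hy, hle, heq⟩ := exists_pos_mulVec_le hπ ht hx hc hW.le
  obtain ⟨v, -⟩ := hc true
  refine le_antisymm (specRad_le_of_mulVec_le le_rfl hy hle) ?_
  rw [specRad_eq_spectralRadius]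
  exact ofReal_le_spectralRadius (Function.ne_iff.2 ⟨v, (hy v).ne'⟩) (heq.2 hW)

lemma eq_cliqueSuspension_of_specRad_eq (hπ : ∀ v, π (π v) = π v) (ht : 0 < t)
    (hx : ∀ v, (fiberExcess π v : ℝ) < t) (hc : ∀ c, (coreClass π col c).Nonempty)
    (hW : classWeight π col t true * classWeight π col t false ≤ t ^ 2)
    {G : SimpleGraph V} (hG : G ≤ cliqueSuspension π col) (h : specRad G = ENNReal.ofReal t) :
    G = cliqueSuspension π col ∧
      classWeight π col t true * classWeight π col t false = t ^ 2 := by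
  obtain ⟨y, hy, hle, heq⟩ := exists_pos_mulVec_le hπ ht hx hc hW
  rw [← heq]
  exact eq_and_mulVec_eq_of_specRad_eq hG (cliqueSuspension_connected hπ hc) hy ht.le hle h

end CliqueSuspension

section Gain

open Finset

variable {t : ℝ}

lemma gain_zero (t : ℝ) : gain t 0 = 0 := zero_div _

lemma gain_pos {x : ℝ} (hx : 0 < x) (hxt : x < t) : 0 < gain t x :=
  div_pos hx (mul_pos (by linarith) (by linarith))

lemma gain_lt_one {x : ℝ} (hx : 0 ≤ x) (hxt : x + 1 ≤ t) : gain t x < 1 := by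
  rw [gain, div_lt_one (mul_pos (by linarith) (by linarith))]
  nlinarith

lemma gain_add_gain_add_le {x y : ℝ} (hx : 0 ≤ x) (hy : 0 ≤ y) (h : x + y < t) :
    gain t x + gain t y + 2 * (gain t x * gain t y) ≤ gain t (x + y) := by
  have hx' : 0 < t - x := by linarith
  have hy' : 0 < t - y := by linarith
  have hxy' : 0 < t - (x + y) := by linarith
  have ht : 0 < t + 1 := by linarith
  have hdiff : gain t (x + y) - (gain t x + gain t y + 2 * (gain t x * gain t y)) =
      x * y * (t * (2 * t - x - y) + x + y) /
        ((t + 1) ^ 2 * (t - x) * (t - y) * (t - (x + y))) := by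
    unfold gain
    field_simp
    ring
  rw [← sub_nonneg, hdiff]
  refine div_nonneg (mul_nonneg (mul_nonneg hx hy) ?_) (by positivity)
  nlinarith

lemma gain_le_div {x y : ℝ} (hx : 0 ≤ x) (hxy : x ≤ y) (hy : y < t) :
    gain t x ≤ x / ((t + 1) * (t - y)) :=
  div_le_div_of_nonneg_left hx (mul_pos (by linarith) (by linarith))
    (mul_le_mul_of_nonneg_left (by linarith) (by linarith))

lemma gain_lt_div {x y : ℝ} (hx : 0 < x) (hxy : x < y) (hy : y < t) :
    gain t x < x / ((t + 1) * (t - y)) :=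
  div_lt_div_of_pos_left hx (mul_pos (by linarith) (by linarith))
    (mul_lt_mul_of_pos_left (by linarith) (by linarith))

variable {ι : Type*} {s : Finset ι} {x : ι → ℝ}

lemma sum_gain_le_gain_sum (hx : ∀ i ∈ s, 0 ≤ x i) (hs : ∑ i ∈ s, x i < t) :
    ∑ i ∈ s, gain t (x i) ≤ gain t (∑ i ∈ s, x i) :=
  calc ∑ i ∈ s, gain t (x i) ≤ ∑ i ∈ s, x i / ((t + 1) * (t - ∑ i ∈ s, x i)) :=
        sum_le_sum fun i hi ↦ gain_le_div (hx i hi) (single_le_sum hx hi) hs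
    _ = gain t (∑ i ∈ s, x i) := (sum_div _ _ _).symm

lemma exists_eq_of_sum_gain_eq (hne : s.Nonempty) (hx : ∀ i ∈ s, 0 ≤ x i) {y : ℝ}
    (hs : ∑ i ∈ s, x i ≤ y) (hy : y < t) (h : ∑ i ∈ s, gain t (x i) = gain t y) :
    ∃ i ∈ s, x i = y := by
  by_contra! hxy
  have hlt : ∀ i ∈ s, x i < y := fun i hi ↦
    ((single_le_sum hx hi).trans hs).lt_of_ne (hxy i hi)
  obtain ⟨j, hj⟩ := hne
  have hy₀ : 0 < y := (hx j hj).trans_lt (hlt j hj)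
  have hle : ∀ i ∈ s, gain t (x i) ≤ x i / ((t + 1) * (t - y)) := fun i hi ↦
    gain_le_div (hx i hi) (hlt i hi).le hy
  have hsum : ∑ i ∈ s, gain t (x i) = ∑ i ∈ s, x i / ((t + 1) * (t - y)) := by
    refine le_antisymm (sum_le_sum hle) ?_
    rw [← sum_div, h, gain]
    exact div_le_div_of_nonneg_right hs (mul_pos (by linarith) (by linarith)).le
  have hzero : ∀ i ∈ s, gain t (x i) = 0 := fun i hi ↦ by
    rcases (hx i hi).eq_or_lt with h₀ | h₀
    · rw [← h₀, gain_zero]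
    · exact absurd ((sum_eq_sum_iff_of_le hle).1 hsum i hi) (gain_lt_div h₀ (hlt i hi) hy).ne
  exact (gain_pos hy₀ hy).ne' (h.symm.trans (sum_eq_zero hzero))

lemma exists_sq_eq_mul_add_gain {a b y : ℝ} (hy : 0 ≤ y) (hya : y + 1 ≤ a) (hab : a ≤ b) :
    ∃ t ≥ a, t ^ 2 = b * (a + gain t y) := by
  have hcont : ContinuousOn (fun t ↦ b * (a + gain t y) - t ^ 2) (Set.Icc a (a + b)) := by
    have hden : ∀ t ∈ Set.Icc a (a + b), (t + 1) * (t - y) ≠ 0 := fun t ht ↦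
      (mul_pos (by linarith [ht.1]) (by linarith [ht.1])).ne'
    unfold gain
    fun_prop (disch := assumption)
  have hleft : 0 ≤ b * (a + gain a y) - a ^ 2 := by
    nlinarith [gain_nonneg hy (by linarith : y < a)]
  have hright : b * (a + gain (a + b) y) - (a + b) ^ 2 ≤ 0 := by
    nlinarith [gain_lt_one hy (by linarith : y + 1 ≤ a + b)]
  obtain ⟨t, ht, h⟩ := intermediate_value_Icc' (by linarith) hcont ⟨hright, hleft⟩
  exact ⟨t, ht.1, (sub_eq_zero.1 h).symm⟩

end Gain

section BalancedProduct

lemma mul_le_half_mul_half (a b : ℕ) : a * b ≤ (a + b) / 2 * ((a + b + 1) / 2) := by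
  wlog hab : a ≤ b generalizing a b
  · rw [mul_comm a, add_comm a]
    exact this b a (le_of_not_ge hab)
  obtain ⟨d, hd⟩ : ∃ d, b = (a + b + 1) / 2 + d := Nat.exists_eq_add_of_le (by omega)
  have ha : (a + b) / 2 = a + d := by omega
  have had : a ≤ (a + b + 1) / 2 := by omega
  calc a * b = a * ((a + b + 1) / 2) + d * a := by rw [mul_comm d, ← mul_add, ← hd]
    _ ≤ a * ((a + b + 1) / 2) + d * ((a + b + 1) / 2) := by gcongr
    _ = (a + b) / 2 * ((a + b + 1) / 2) := by rw [ha, add_mul]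

variable {f f₁ f₂ : ℝ}

lemma balanced_mul_sub_mul_eq (a b e h f f₁ f₂ : ℝ) :
    e * (h + f) - (a + f₁) * (b + f₂) =
      (e * (h + 1) - (a + 1) * b) + (b - e) * (1 - f) + b * (f - (f₁ + f₂ + 2 * (f₁ * f₂))) +
        (b - a) * f₂ + (2 * b - 1) * (f₁ * f₂) := by
  ring

lemma mul_le_balanced_mul_and_of_eq {a b e h : ℝ} (hab : a ≤ b) (hb : 1 ≤ b) (he : e ≤ b)
    (heh : (a + 1) * b ≤ e * (h + 1)) (h₁ : 0 ≤ f₁) (h₂ : 0 ≤ f₂)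
    (hf : f₁ + f₂ + 2 * (f₁ * f₂) ≤ f) (hf_lt : f < 1) :
    (a + f₁) * (b + f₂) ≤ e * (h + f) ∧
      ((a + f₁) * (b + f₂) = e * (h + f) → b = e ∧ (f₁ = f ∨ a = b ∧ f₂ = f)) := by
  have hsize : 0 ≤ (b - e) * (1 - f) := mul_nonneg (sub_nonneg.2 he) (sub_nonneg.2 hf_lt.le)
  have hgain : 0 ≤ b * (f - (f₁ + f₂ + 2 * (f₁ * f₂))) :=
    mul_nonneg (by linarith) (sub_nonneg.2 hf)
  have hside : 0 ≤ (b - a) * f₂ := mul_nonneg (sub_nonneg.2 hab) h₂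
  have hboth : 0 ≤ (2 * b - 1) * (f₁ * f₂) := mul_nonneg (by linarith) (mul_nonneg h₁ h₂)
  have hsum := balanced_mul_sub_mul_eq a b e h f f₁ f₂
  refine ⟨by linarith only [hsum, heh, hsize, hgain, hside, hboth], fun heq ↦ ?_⟩
  have hsize₀ : (b - e) * (1 - f) = 0 := by linarith
  have hgain₀ : b * (f - (f₁ + f₂ + 2 * (f₁ * f₂))) = 0 := by linarith
  have hside₀ : (b - a) * f₂ = 0 := by linarith
  have hboth₀ : (2 * b - 1) * (f₁ * f₂) = 0 := by linarith
  have hf_eq := (mul_eq_zero.1 hgain₀).resolve_left (by linarith)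
  refine ⟨sub_eq_zero.1 ((mul_eq_zero.1 hsize₀).resolve_right (by linarith)), ?_⟩
  rcases mul_eq_zero.1 ((mul_eq_zero.1 hboth₀).resolve_left (by linarith)) with h₀ | h₀ <;>
    rw [h₀] at hf_eq
  · refine (mul_eq_zero.1 hside₀).elim (fun hab₀ ↦ Or.inr ⟨?_, ?_⟩) (fun h₀' ↦ Or.inl ?_) <;>
      linarith
  · exact Or.inl (by linarith)

lemma mul_le_half_mul_and_of_eq {a b : ℕ} (hab : a ≤ b) (hb : 1 ≤ b) (h₁ : 0 ≤ f₁)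
    (h₂ : 0 ≤ f₂) (hf : f₁ + f₂ + 2 * (f₁ * f₂) ≤ f) (hf_lt : f < 1) :
    (a + f₁) * (b + f₂) ≤ ((a + b + 1) / 2 : ℕ) * (((a + b) / 2 : ℕ) + f) ∧
      ((a + f₁) * (b + f₂) = ((a + b + 1) / 2 : ℕ) * (((a + b) / 2 : ℕ) + f) →
        b = (a + b + 1) / 2 ∧ (f₁ = f ∨ a = b ∧ f₂ = f)) := by
  have hprod := mul_le_half_mul_half (a + 1) b
  rw [add_right_comm, (by omega : (a + b + 1 + 1) / 2 = (a + b) / 2 + 1)] at hprod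
  simpa only [Nat.cast_inj] using mul_le_balanced_mul_and_of_eq (a := a) (b := b)
    (e := ((a + b + 1) / 2 : ℕ)) (h := ((a + b) / 2 : ℕ)) (mod_cast hab) (mod_cast hb)
    (Nat.cast_le.2 (by omega)) (mod_cast hprod) h₁ h₂ hf hf_lt

end BalancedProduct

section Identify

open Set

variable {V W : Type*}

lemma induce_sup_induce_identify (G : SimpleGraph V) (u : V) (H : SimpleGraph W) (v : W) :
    (⊤ : (identify G u H v).Subgraph).induce (range Sum.inl) ⊔
      (⊤ : (identify G u H v).Subgraph).induce (insert (.inl u) (range Sum.inr)) = ⊤ := by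
  refine SimpleGraph.Subgraph.ext ?_ ?_
  · ext (x | w) <;> simp
  · ext (x | w) (y | z) <;>
      simp only [SimpleGraph.Subgraph.sup_adj, SimpleGraph.Subgraph.induce_adj,
        SimpleGraph.Subgraph.top_adj] <;>
      simp +contextual [identify]

variable [Fintype V] [Fintype W] [DecidableEq W]

lemma card_sum_ne (v : W) :
    Fintype.card (V ⊕ {w : W // w ≠ v}) = Fintype.card V + Fintype.card W - 1 := by
  have : 0 < Fintype.card W := Fintype.card_pos_iff.2 ⟨v⟩
  rw [Fintype.card_sum, Fintype.card_subtype_compl, Fintype.card_subtype_eq]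
  omega

lemma isBipartiteSuspension_identify {G : SimpleGraph V} (hG : G.IsBipartite) (u : V)
    (H : SimpleGraph W) (v : W) :
    IsBipartiteSuspension (Fintype.card V + Fintype.card W - 1) (Fintype.card W + 1)
      (identify G u H v) := by
  let B : (identify G u H v).Subgraph := (⊤ : (identify G u H v).Subgraph).induce (range Sum.inl)
  let K : (identify G u H v).Subgraph :=
    (⊤ : (identify G u H v).Subgraph).induce (insert (.inl u) (range Sum.inr))
  have hdiff : K.verts \ B.verts = range Sum.inr := by
    ext (x | w) <;> simp [B, K]
  refine ⟨card_sum_ne v, B, 1, fun _ ↦ K, ?_, fun _ ↦ ⟨.inl u, ?_⟩,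
    fun i j hij ↦ absurd (Subsingleton.elim i j) hij, ?_, ?_⟩
  · refine hG.of_hom ⟨fun x ↦ x.2.choose, fun {x y} h ↦ ?_⟩
    have hadj : (identify G u H v).Adj x.1 y.1 := B.coe_adj_sub _ _ h
    rwa [← x.2.choose_spec, ← y.2.choose_spec] at hadj
  · ext (x | w) <;> simp [B, K]
  · rw [ciSup_const]
    exact induce_sup_induce_identify G u H v
  · have : 0 < Fintype.card W := Fintype.card_pos_iff.2 ⟨v⟩
    rw [Fintype.sum_unique, hdiff, ← image_univ, ncard_image_of_injective _ Sum.inr_injective,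
      ncard_univ, Nat.card_eq_fintype_card, Fintype.card_subtype_compl, Fintype.card_subtype_eq]
    omega

end Identify

section TuranCircClique

open Finset

variable {m q : ℕ} {t : ℝ}

lemma isBipartiteSuspension_turanCircClique (hm : 2 ≤ m) (hq : 1 ≤ q) :
    IsBipartiteSuspension (m + q - 1) (q + 1) (turanCircClique m q hm hq) := by
  have hbip : (SimpleGraph.turanGraph m 2).IsBipartite :=
    ⟨.mk (fun x ↦ Fin.ofNat 2 x) fun h h' ↦ h (by simpa [Fin.ext_iff] using h')⟩
  simpa only [turanCircClique, Fintype.card_fin] using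
    isBipartiteSuspension_identify hbip ⟨1, hm⟩ ⊤ (⟨0, hq⟩ : Fin q)

/-- The retraction of `turanCircClique` onto its Turán graph that maps the clique to the vertex at
which it is attached. -/
def turanRetract (hm : 2 ≤ m) (hq : 1 ≤ q) :
    Fin m ⊕ {w : Fin q // w ≠ ⟨0, hq⟩} → Fin m ⊕ {w : Fin q // w ≠ ⟨0, hq⟩}
  | .inl x => .inl x
  | .inr _ => .inl ⟨1, hm⟩

/-- The 2-colouring of the Turán graph in `turanCircClique` in which `true` is the colour of the
class of size `m / 2`; the value off the Turán graph is arbitrary. -/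
def turanColor (m : ℕ) (hq : 1 ≤ q) : Fin m ⊕ {w : Fin q // w ≠ ⟨0, hq⟩} → Bool
  | .inl x => decide ((x : ℕ) % 2 = 1)
  | .inr _ => false

lemma turanRetract_turanRetract (hm : 2 ≤ m) (hq : 1 ≤ q)
    (v : Fin m ⊕ {w : Fin q // w ≠ ⟨0, hq⟩}) :
    turanRetract hm hq (turanRetract hm hq v) = turanRetract hm hq v := by
  rcases v with x | w <;> rfl

lemma turanCircClique_eq_cliqueSuspension (hm : 2 ≤ m) (hq : 1 ≤ q) :
    turanCircClique m q hm hq = cliqueSuspension (turanRetract hm hq) (turanColor m hq) := by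
  ext (x | v) (y | w)
  · have hcol : decide ((x : ℕ) % 2 = 1) ≠ decide ((y : ℕ) % 2 = 1) ↔ (x : ℕ) % 2 ≠ y % 2 := by
      rw [Ne, decide_eq_decide]
      omega
    by_cases h : x = y <;>
      simp [turanCircClique, identify, cliqueSuspension_adj, turanRetract, turanColor,
        SimpleGraph.turanGraph_adj, h, hcol]
  · simp [turanCircClique, identify, cliqueSuspension_adj, turanRetract, w.2.symm]
  · simp [turanCircClique, identify, cliqueSuspension_adj, turanRetract, v.2.symm, eq_comm (a := y)]
  · simp [turanCircClique, identify, cliqueSuspension_adj, turanRetract, Subtype.ext_iff]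

lemma coreClass_turan (hm : 2 ≤ m) (hq : 1 ≤ q) (c : Bool) :
    coreClass (turanRetract hm hq) (turanColor m hq) c =
      ({x : Fin m | decide ((x : ℕ) % 2 = 1) = c} : Finset _).map .inl := by
  ext (x | w) <;> simp [turanRetract, turanColor]

lemma card_filter_odd (m : ℕ) : #{x : Fin m | (x : ℕ) % 2 = 1} = m / 2 := by
  rw [card_filter, Fin.sum_univ_eq_sum_range fun i ↦ if i % 2 = 1 then 1 else 0]
  induction m with
  | zero => rfl
  | succ k ih =>
    rw [sum_range_succ, ih]
    split_ifs <;> omega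

lemma card_coreClass_turan_true (hm : 2 ≤ m) (hq : 1 ≤ q) :
    #(coreClass (turanRetract hm hq) (turanColor m hq) true) = m / 2 := by
  simpa [coreClass_turan] using card_filter_odd m

lemma card_coreClass_turan_false (hm : 2 ≤ m) (hq : 1 ≤ q) :
    #(coreClass (turanRetract hm hq) (turanColor m hq) false) = (m + 1) / 2 := by
  have hsum := card_filter_add_card_filter_not (s := (univ : Finset (Fin m)))
    fun x ↦ (x : ℕ) % 2 = 1
  rw [card_filter_odd, card_univ, Fintype.card_fin] at hsum
  rw [coreClass_turan, card_map]
  simp only [decide_eq_false_iff_not]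
  omega

lemma coreClass_turan_nonempty (hm : 2 ≤ m) (hq : 1 ≤ q) (c : Bool) :
    (coreClass (turanRetract hm hq) (turanColor m hq) c).Nonempty := by
  rw [← card_pos]
  cases c
  · rw [card_coreClass_turan_false]
    omega
  · rw [card_coreClass_turan_true]
    omega

lemma fiberExcess_turan (hm : 2 ≤ m) (hq : 1 ≤ q) (v : Fin m ⊕ {w : Fin q // w ≠ ⟨0, hq⟩}) :
    fiberExcess (turanRetract hm hq) v = if v = .inl ⟨1, hm⟩ then q - 1 else 0 := by
  split_ifs with hv
  · subst hv
    have hfiber : ({w | turanRetract hm hq w = .inl ⟨1, hm⟩ ∧ w ≠ .inl ⟨1, hm⟩} : Finset _) =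
        univ.map .inr := by
      ext (x | w) <;> simp only [mem_filter_univ] <;> simp [turanRetract]
    rw [fiberExcess, hfiber, card_map, card_univ, Fintype.card_subtype_compl, Fintype.card_fin,
      Fintype.card_subtype_eq]
  · rw [fiberExcess, card_eq_zero, filter_eq_empty_iff]
    rintro (x | w) - ⟨hw, hne⟩
    exacts [hne hw, hv hw.symm]

lemma fiberExcess_turan_lt (hm : 2 ≤ m) (hq : 1 ≤ q) (ht : ((q - 1 : ℕ) : ℝ) < t)
    (v : Fin m ⊕ {w : Fin q // w ≠ ⟨0, hq⟩}) :
    (fiberExcess (turanRetract hm hq) v : ℝ) < t := by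
  refine lt_of_le_of_lt (Nat.cast_le.2 ?_) ht
  rw [fiberExcess_turan]
  split_ifs
  exacts [le_rfl, Nat.zero_le _]

lemma classWeight_turan_mul (hm : 2 ≤ m) (hq : 1 ≤ q) (t : ℝ) :
    classWeight (turanRetract hm hq) (turanColor m hq) t true *
        classWeight (turanRetract hm hq) (turanColor m hq) t false =
      ((m + 1) / 2 : ℕ) * ((m / 2 : ℕ) + gain t (q - 1 : ℕ)) := by
  have hgain : ∀ v, gain t (fiberExcess (turanRetract hm hq) v) =
      if v = .inl ⟨1, hm⟩ then gain t (q - 1 : ℕ) else 0 := fun v ↦ by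
    rw [fiberExcess_turan]
    split_ifs
    exacts [rfl, by rw [Nat.cast_zero, gain_zero]]
  have htrue : classGain (turanRetract hm hq) (turanColor m hq) t true = gain t (q - 1 : ℕ) := by
    simp only [classGain, hgain, sum_ite_eq']
    exact if_pos (mem_coreClass.2 ⟨by rfl, by rfl⟩)
  have hfalse : classGain (turanRetract hm hq) (turanColor m hq) t false = 0 := by
    simp only [classGain, hgain, sum_ite_eq']
    exact if_neg fun h ↦ absurd (mem_coreClass.1 h).2 (by simp [turanColor])
  rw [classWeight, classWeight, htrue, hfalse, card_coreClass_turan_true,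
    card_coreClass_turan_false]
  ring

lemma specRad_turanCircClique_eq (hm : 2 ≤ m) (hq : 1 ≤ q) (ht : ((q - 1 : ℕ) : ℝ) < t)
    (h : t ^ 2 = ((m + 1) / 2 : ℕ) * ((m / 2 : ℕ) + gain t (q - 1 : ℕ))) :
    specRad (turanCircClique m q hm hq) = ENNReal.ofReal t := by
  rw [turanCircClique_eq_cliqueSuspension]
  exact specRad_cliqueSuspension_eq (turanRetract_turanRetract hm hq)
    ((Nat.cast_nonneg _).trans_lt ht) (fiberExcess_turan_lt hm hq ht)
    (coreClass_turan_nonempty hm hq) ((classWeight_turan_mul hm hq t).trans h.symm)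

lemma specRad_turanCircClique_lt_ofReal (hm : 2 ≤ m) (hq : 1 ≤ q)
    (ht : ((q - 1 : ℕ) : ℝ) < t)
    (h : ((m + 1) / 2 : ℕ) * ((m / 2 : ℕ) + gain t (q - 1 : ℕ)) < t ^ 2) :
    specRad (turanCircClique m q hm hq) < ENNReal.ofReal t := by
  rw [← classWeight_turan_mul hm hq] at h
  rw [turanCircClique_eq_cliqueSuspension]
  have hidem := turanRetract_turanRetract hm hq
  have ht₀ := (Nat.cast_nonneg _).trans_lt ht
  have hexcess := fiberExcess_turan_lt hm hq ht
  have hne := coreClass_turan_nonempty hm hq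
  exact (specRad_le_of_le_cliqueSuspension hidem ht₀ hexcess hne h.le le_rfl).lt_of_ne fun heq ↦
    h.ne (eq_cliqueSuspension_of_specRad_eq hidem ht₀ hexcess hne h.le le_rfl heq).2

lemma exists_specRad_turanCircClique_eq (hm : 2 ≤ m) (hq : 1 ≤ q) (hqm : q ≤ m / 2) :
    ∃ t : ℝ, ((m / 2 : ℕ) : ℝ) ≤ t ∧
      t ^ 2 = ((m + 1) / 2 : ℕ) * ((m / 2 : ℕ) + gain t (q - 1 : ℕ)) ∧
      specRad (turanCircClique m q hm hq) = ENNReal.ofReal t := by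
  have hq' : ((q - 1 : ℕ) : ℝ) + 1 ≤ (m / 2 : ℕ) := by
    exact_mod_cast (by omega : q - 1 + 1 ≤ m / 2)
  obtain ⟨t, hmt, ht⟩ := exists_sq_eq_mul_add_gain (Nat.cast_nonneg _) hq'
    (Nat.cast_le.2 (by omega : m / 2 ≤ (m + 1) / 2))
  exact ⟨t, hmt, ht, specRad_turanCircClique_eq hm hq (by linarith) ht⟩

lemma specRad_turanCircClique_lt {m' q' : ℕ} (hm : 2 ≤ m) (hq : 1 ≤ q) (hm' : 2 ≤ m')
    (hq' : 1 ≤ q') (hsum : m' + q' = m + q) (hlt : q < q') (hqm' : q' ≤ m' / 2) :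
    specRad (turanCircClique m' q' hm' hq') < specRad (turanCircClique m q hm hq) := by
  obtain ⟨t, hmt, ht, hspec⟩ := exists_specRad_turanCircClique_eq hm hq (by omega)
  have ht_gt : ((q' - 1 : ℕ) : ℝ) + 1 ≤ t := by
    refine le_trans ?_ hmt
    exact_mod_cast (by omega : q' - 1 + 1 ≤ m / 2)
  have hgain : 0 ≤ gain t (q - 1 : ℕ) := by
    refine gain_nonneg (Nat.cast_nonneg _) (lt_of_lt_of_le (Nat.cast_lt.2 ?_) hmt)
    omega
  have hhalf : (m' + 1) / 2 * (m' / 2 + 1) ≤ (m + 1) / 2 * (m / 2) := by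
    refine (mul_le_half_mul_half _ _).trans ?_
    rw [mul_comm]
    exact Nat.mul_le_mul (by omega) (by omega)
  rw [hspec]
  refine specRad_turanCircClique_lt_ofReal hm' hq' (by linarith) ?_
  calc ((m' + 1) / 2 : ℕ) * ((m' / 2 : ℕ) + gain t (q' - 1 : ℕ))
      < ((m' + 1) / 2 : ℕ) * ((m' / 2 : ℕ) + 1 : ℝ) :=
        mul_lt_mul_of_pos_left
          (add_lt_add_right (gain_lt_one (Nat.cast_nonneg _) ht_gt) _)
          (Nat.cast_pos.2 (by omega))
    _ ≤ ((m + 1) / 2 : ℕ) * (m / 2 : ℕ) := by exact_mod_cast hhalf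
    _ ≤ ((m + 1) / 2 : ℕ) * ((m / 2 : ℕ) + gain t (q - 1 : ℕ)) :=
        mul_le_mul_of_nonneg_left (le_add_of_nonneg_right hgain) (Nat.cast_nonneg _)
    _ = t ^ 2 := ht.symm

end TuranCircClique

section Retraction

open Finset

variable {V : Type*}

lemma exists_surjective_coloring_bool [Nontrivial V] {G : SimpleGraph V} (hG : G.IsBipartite) :
    ∃ C : G.Coloring Bool, Function.Surjective C := by
  classical
  by_cases hbot : G = ⊥
  · obtain ⟨a, b, hab⟩ := exists_pair_ne V
    refine ⟨.mk (fun v ↦ decide (v = a)) fun {v w} h ↦ absurd h (by simp [hbot]), ?_⟩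
    rintro (_ | _)
    exacts [⟨b, decide_eq_false hab.symm⟩, ⟨a, decide_eq_true rfl⟩]
  · obtain ⟨a, b, hab⟩ := SimpleGraph.ne_bot_iff_exists_adj.1 hbot
    let C : G.Coloring Bool := hG.toColoring le_rfl
    refine ⟨C, fun c ↦ ?_⟩
    by_cases hc : C a = c
    exacts [⟨a, hc⟩, ⟨b, ((Bool.eq_or_eq_not (C b) (C a)).resolve_left (C.valid hab).symm).trans
      (Bool.not_eq.2 hc)⟩]

variable [Fintype V] {G : SimpleGraph V} {n r : ℕ}

lemma IsBipartiteSuspension.exists_retraction (hG : IsBipartiteSuspension n r G) :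
    ∃ (B : G.Subgraph) (π : V → V), B.coe.IsBipartite ∧ (∀ v, π v ∈ B.verts) ∧
      (∀ v ∈ B.verts, π v = v) ∧ (∀ v w, G.Adj v w → B.Adj v w ∨ π v = π w) ∧
      B.vertsᶜ.ncard + 2 = r := by
  obtain ⟨-, B, s, H, hB, hmeet, hdisj, htop, hcard⟩ := hG
  choose u hu using hmeet
  have hcover : ∀ v, v ∈ B.verts ∨ ∃ i, v ∈ (H i).verts := fun v ↦ by
    have hv : v ∈ (B ⊔ ⨆ i, H i).verts := htop ▸ Set.mem_univ v
    simpa using hv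
  have hindex : ∀ v ∉ B.verts, ∀ i j, v ∈ (H i).verts → v ∈ (H j).verts → i = j :=
    fun v hv i j hi hj ↦ by_contra fun hij ↦ hv (hdisj i j hij ⟨hi, hj⟩)
  have hexists : ∀ v, ∃ x ∈ B.verts, (v ∈ B.verts → x = v) ∧ ∀ i, v ∈ (H i).verts → x = u i := by
    intro v
    by_cases hv : v ∈ B.verts
    · exact ⟨v, hv, fun _ ↦ rfl, fun i hi ↦ (hu i).subset ⟨hi, hv⟩⟩
    · obtain ⟨i, hi⟩ := (hcover v).resolve_left hv
      exact ⟨u i, ((hu i).superset rfl).2, fun h ↦ absurd h hv,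
        fun j hj ↦ congrArg u (hindex v hv i j hi hj)⟩
  choose π hmem hid hπ using hexists
  refine ⟨B, π, hB, hmem, hid, fun v w h ↦ ?_, ?_⟩
  · have hvw : (B ⊔ ⨆ i, H i).Adj v w := htop ▸ h
    rw [SimpleGraph.Subgraph.sup_adj, SimpleGraph.Subgraph.iSup_adj] at hvw
    exact hvw.imp_right fun ⟨i, hi⟩ ↦ (hπ v i hi.fst_mem).trans (hπ w i hi.snd_mem).symm
  · have hcompl : B.vertsᶜ = ⋃ i, (H i).verts \ B.verts := by
      ext v
      simp only [Set.mem_compl_iff, Set.mem_iUnion, Set.mem_sdiff]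
      exact ⟨fun hv ↦ ((hcover v).resolve_left hv).imp fun i hi ↦ ⟨hi, hv⟩, fun ⟨_, hi⟩ ↦ hi.2⟩
    rw [← hcard, hcompl, Set.ncard_iUnion_of_finite (fun _ ↦ Set.toFinite _) fun i j hij ↦
      Set.disjoint_left.2 fun v hi hj ↦ hij (hindex v hi.2 i j hi.1 hj.1),
      finsum_eq_sum_of_fintype]

variable [DecidableEq V]

lemma IsBipartiteSuspension.exists_le_cliqueSuspension (hG : IsBipartiteSuspension n r G)
    (hrn : r ≤ n) :
    ∃ (π : V → V) (col : V → Bool), (∀ v, π (π v) = π v) ∧ G ≤ cliqueSuspension π col ∧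
      (∀ c, (coreClass π col c).Nonempty) ∧ #{v | π v ≠ v} + 2 = r := by
  obtain ⟨B, π, hB, hmem, hid, hadj, hcard⟩ := hG.exists_retraction
  have hfixed : ∀ v, π v = v ↔ v ∈ B.verts := fun v ↦ ⟨fun h ↦ h ▸ hmem v, hid v⟩
  have hverts : 1 < B.verts.ncard := by
    have hsum := Set.ncard_add_ncard_compl B.verts
    rw [Nat.card_eq_fintype_card, hG.1] at hsum
    omega
  have : Nontrivial B.verts :=
    Set.nontrivial_coe_sort.2 (Set.one_lt_ncard_iff_nontrivial.1 hverts)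
  obtain ⟨C, hC⟩ := exists_surjective_coloring_bool hB
  refine ⟨π, fun v ↦ C ⟨π v, hmem v⟩, fun v ↦ hid _ (hmem v), fun v w h ↦ ⟨h.ne, ?_⟩,
    fun c ↦ ?_, ?_⟩
  · refine (hadj v w h).symm.imp_right fun hvw ↦ ?_
    have hv := hid v hvw.fst_mem
    have hw := hid w hvw.snd_mem
    exact ⟨hv, hw, C.valid (show B.Adj (π v) (π w) by rwa [hv, hw])⟩
  · obtain ⟨⟨v, hv⟩, rfl⟩ := hC c
    exact ⟨v, mem_coreClass.2 ⟨hid v hv, congrArg C (Subtype.ext (hid v hv))⟩⟩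
  · rw [← hcard, ← Set.ncard_coe_finset]
    congr 2
    ext v
    simp [hfixed]

lemma IsBipartiteSuspension.exists_le_cliqueSuspension_card_le (hG : IsBipartiteSuspension n r G)
    (hrn : r ≤ n) :
    ∃ (π : V → V) (col : V → Bool), (∀ v, π (π v) = π v) ∧ G ≤ cliqueSuspension π col ∧
      (∀ c, (coreClass π col c).Nonempty) ∧ #{v | π v ≠ v} + 2 = r ∧
      #(coreClass π col true) ≤ #(coreClass π col false) := by
  obtain ⟨π, col, hπ, hle, hne, hcard⟩ := hG.exists_le_cliqueSuspension hrn
  rcases le_total (#(coreClass π col true)) #(coreClass π col false) with hcol | hcol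
  · exact ⟨π, col, hπ, hle, hne, hcard, hcol⟩
  · refine ⟨π, fun v ↦ !col v, hπ, by rwa [cliqueSuspension_not], fun c ↦ ?_, hcard, ?_⟩
    · rw [coreClass_not]
      exact hne _
    · rwa [coreClass_not, coreClass_not]

end Retraction

section Concentration

open Finset

variable {V : Type*} [Fintype V] [DecidableEq V] {π : V → V} {t : ℝ}

lemma fiberExcess_eq (π : V → V) (v : V) :
    fiberExcess π v = #{w ∈ ({w | π w ≠ w} : Finset V) | π w = v} := by
  rw [fiberExcess, filter_filter]
  congr! 2 with w
  constructor
  · rintro ⟨rfl, h⟩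
    exact ⟨h.symm, rfl⟩
  · rintro ⟨h, rfl⟩
    exact ⟨rfl, h.symm⟩

lemma fiberExcess_le (π : V → V) (v : V) : fiberExcess π v ≤ #{w | π w ≠ w} := by
  rw [fiberExcess_eq]
  exact card_filter_le _ _

lemma apply_eq_of_fiberExcess_eq {u : V} (hu : fiberExcess π u = #{w | π w ≠ w}) {v : V}
    (hv : π v ≠ v) : π v = u := by
  rw [fiberExcess_eq, card_filter_eq_iff] at hu
  exact hu v ((mem_filter_univ v).2 hv)

lemma sum_fiberExcess_add_sum_fiberExcess (hπ : ∀ v, π (π v) = π v) (col : V → Bool) :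
    ∑ v ∈ coreClass π col true, fiberExcess π v + ∑ v ∈ coreClass π col false, fiberExcess π v =
      #{v | π v ≠ v} := by
  simp only [fiberExcess_eq, sum_card_fiberwise_eq_card_filter, mem_coreClass, hπ, true_and]
  simpa using card_filter_add_card_filter_not (s := ({v | π v ≠ v} : Finset V))
    fun v ↦ col (π v) = true

lemma card_coreClass_add_card_coreClass (π : V → V) (col : V → Bool) :
    #(coreClass π col true) + #(coreClass π col false) + #{v | π v ≠ v} = Fintype.card V := by
  have hcol := card_filter_add_card_filter_not (s := ({v | π v = v} : Finset V))
    fun v ↦ col v = true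
  simp only [filter_filter, Bool.not_eq_true] at hcol
  rw [coreClass, coreClass, hcol]
  exact card_filter_add_card_filter_not _

variable {col : V → Bool}

lemma sum_fiberExcess_le (hπ : ∀ v, π (π v) = π v) (c : Bool) :
    ∑ v ∈ coreClass π col c, (fiberExcess π v : ℝ) ≤ #{v | π v ≠ v} := by
  rw [← Nat.cast_sum, ← sum_fiberExcess_add_sum_fiberExcess hπ col, Nat.cast_le]
  cases c
  exacts [Nat.le_add_left _ _, Nat.le_add_right _ _]

lemma classGain_add_classGain_add_le (hπ : ∀ v, π (π v) = π v)
    (ht : (#{v | π v ≠ v} : ℝ) < t) :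
    classGain π col t true + classGain π col t false +
      2 * (classGain π col t true * classGain π col t false) ≤ gain t #{v | π v ≠ v} := by
  have hx : ∀ v, (fiberExcess π v : ℝ) < t := fun v ↦
    (Nat.cast_le.2 (fiberExcess_le π v)).trans_lt ht
  set x : Bool → ℝ := fun c ↦ ∑ v ∈ coreClass π col c, (fiberExcess π v : ℝ)
  have hx₀ : ∀ c, 0 ≤ x c := fun c ↦ sum_nonneg fun v _ ↦ Nat.cast_nonneg _
  have hsum : x true + x false = #{v | π v ≠ v} := by
    rw [← sum_fiberExcess_add_sum_fiberExcess hπ col]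
    push_cast
    rfl
  have hgain : ∀ c, classGain π col t c ≤ gain t (x c) := fun c ↦
    sum_gain_le_gain_sum (fun v _ ↦ Nat.cast_nonneg _) ((sum_fiberExcess_le hπ c).trans_lt ht)
  have hprod : classGain π col t true * classGain π col t false ≤
      gain t (x true) * gain t (x false) :=
    mul_le_mul (hgain true) (hgain false) (classGain_nonneg hx false)
      ((classGain_nonneg hx true).trans (hgain true))
  calc classGain π col t true + classGain π col t false +
        2 * (classGain π col t true * classGain π col t false)
      ≤ gain t (x true) + gain t (x false) + 2 * (gain t (x true) * gain t (x false)) := by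
        linarith [hgain true, hgain false]
    _ ≤ gain t (x true + x false) :=
        gain_add_gain_add_le (hx₀ true) (hx₀ false) (hsum.trans_lt ht)
    _ = gain t #{v | π v ≠ v} := by rw [hsum]

lemma exists_forall_apply_eq_of_classGain_eq (hπ : ∀ v, π (π v) = π v)
    (ht : (#{v | π v ≠ v} : ℝ) < t) {c : Bool} (hc : (coreClass π col c).Nonempty)
    (h : classGain π col t c = gain t #{v | π v ≠ v}) :
    ∃ u ∈ coreClass π col c, ∀ v, π v ≠ v → π v = u := by
  obtain ⟨u, hu, hexcess⟩ := exists_eq_of_sum_gain_eq hc (fun v _ ↦ Nat.cast_nonneg _)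
    (sum_fiberExcess_le hπ c) ht h
  exact ⟨u, hu, fun v ↦ apply_eq_of_fiberExcess_eq (Nat.cast_injective hexcess)⟩

lemma classWeight_mul_le_and_of_eq (hπ : ∀ v, π (π v) = π v) (ht : (#{v | π v ≠ v} : ℝ) + 1 ≤ t)
    (hne : (coreClass π col false).Nonempty)
    (hcol : #(coreClass π col true) ≤ #(coreClass π col false)) {m : ℕ}
    (hm : #(coreClass π col true) + #(coreClass π col false) = m) :
    classWeight π col t true * classWeight π col t false ≤
        ((m + 1) / 2 : ℕ) * ((m / 2 : ℕ) + gain t #{v | π v ≠ v}) ∧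
      (classWeight π col t true * classWeight π col t false =
          ((m + 1) / 2 : ℕ) * ((m / 2 : ℕ) + gain t #{v | π v ≠ v}) →
        #(coreClass π col false) = (m + 1) / 2 ∧
          (classGain π col t true = gain t #{v | π v ≠ v} ∨
            #(coreClass π col true) = #(coreClass π col false) ∧
              classGain π col t false = gain t #{v | π v ≠ v})) := by
  have hlt : (#{v | π v ≠ v} : ℝ) < t := by linarith
  have hgain := classGain_nonneg (col := col) fun v ↦
    (Nat.cast_le.2 (fiberExcess_le π v)).trans_lt hlt
  subst hm
  exact mul_le_half_mul_and_of_eq hcol hne.card_pos (hgain true) (hgain false)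
    (classGain_add_classGain_add_le hπ hlt) (gain_lt_one (Nat.cast_nonneg _) ht)

end Concentration

section Isomorphism

open Finset

lemma exists_equiv_comp_eq_and_apply_eq {α β γ : Type*} [Fintype α] [Fintype β] [DecidableEq γ]
    {f : α → γ} {g : β → γ} (h : ∀ c, #{x | f x = c} = #{y | g y = c}) {a : α} {b : β}
    (hab : f a = g b) : ∃ e : α ≃ β, (∀ x, g (e x) = f x) ∧ e a = b := by
  classical
  have hfiber : ∀ c, Nonempty ({x // f x = c} ≃ {y // g y = c}) := fun c ↦
    Fintype.card_eq.1 (by rw [Fintype.card_subtype, Fintype.card_subtype, h])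
  let e : α ≃ β := Equiv.ofFiberEquiv fun c ↦ (hfiber c).some
  have he : ∀ x, g (e x) = f x := Equiv.ofFiberEquiv_map _
  refine ⟨e.trans (Equiv.swap (e a) b), fun x ↦ ?_, Equiv.swap_apply_left _ _⟩
  rw [Equiv.trans_apply, Equiv.swap_apply_def, ← he]
  split_ifs with hx hx
  · rw [hx, ← hab, he]
  · rw [hx, he, hab]
  · rfl

variable {V W : Type*} {π : V → V} {col : V → Bool} {π' : W → W} {col' : W → Bool}

lemma nonempty_iso_cliqueSuspension (e : V ≃ W) (hπ : ∀ v, π' (e v) = e (π v))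
    (hcol : ∀ v, π v = v → col' (e v) = col v) :
    Nonempty (cliqueSuspension π col ≃g cliqueSuspension π' col') := by
  refine ⟨⟨e, fun {v w} ↦ ?_⟩⟩
  simp only [cliqueSuspension_adj, hπ, e.apply_eq_iff_eq, Ne]
  refine and_congr_right fun _ ↦ or_congr_right <|
    and_congr_right fun hv ↦ and_congr_right fun hw ↦ ?_
  rw [hcol v hv, hcol w hw]

variable [DecidableEq V] [DecidableEq W]

/-- The colour of a vertex of the core, and `none` off the core. -/
def coreColor (π : V → V) (col : V → Bool) (v : V) : Option Bool :=
  if π v = v then some (col v) else none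

lemma coreColor_eq_some_iff {v : V} {c : Bool} :
    coreColor π col v = some c ↔ π v = v ∧ col v = c := by
  simp [coreColor]

lemma coreColor_eq_none_iff {v : V} : coreColor π col v = none ↔ π v ≠ v := by
  simp [coreColor]

variable [Fintype V] [Fintype W]

lemma nonempty_iso_cliqueSuspension_of_card_eq {u : V} {u' : W} (hu : u ∈ coreClass π col true)
    (hu' : u' ∈ coreClass π' col' true) (hπ : ∀ v, π v ≠ v → π v = u)
    (hπ' : ∀ v, π' v ≠ v → π' v = u')
    (hcore : ∀ c, #(coreClass π col c) = #(coreClass π' col' c))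
    (hcard : Fintype.card V = Fintype.card W) :
    Nonempty (cliqueSuspension π col ≃g cliqueSuspension π' col') := by
  have hfiber : ∀ c, #{v | coreColor π col v = c} = #{w | coreColor π' col' w = c} := by
    rintro (_ | c)
    · simp only [coreColor_eq_none_iff]
      have h := card_coreClass_add_card_coreClass π col
      have h' := card_coreClass_add_card_coreClass π' col'
      have htrue := hcore true
      have hfalse := hcore false
      omega
    · simp only [coreColor_eq_some_iff]
      exact hcore c
  have hroot : coreColor π col u = coreColor π' col' u' :=
    (coreColor_eq_some_iff.2 (mem_coreClass.1 hu)).trans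
      (coreColor_eq_some_iff.2 (mem_coreClass.1 hu')).symm
  obtain ⟨e, he, heu⟩ := exists_equiv_comp_eq_and_apply_eq hfiber hroot
  have hsome : ∀ v, π v = v → π' (e v) = e v ∧ col' (e v) = col v := fun v hv ↦
    coreColor_eq_some_iff.1 ((he v).trans (coreColor_eq_some_iff.2 ⟨hv, rfl⟩))
  refine nonempty_iso_cliqueSuspension e (fun v ↦ ?_) fun v hv ↦ (hsome v hv).2
  by_cases hv : π v = v
  · rw [hv, (hsome v hv).1]
  · have hev : π' (e v) ≠ e v :=
      coreColor_eq_none_iff.1 ((he v).trans (coreColor_eq_none_iff.2 hv))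
    rw [hπ v hv, heu, hπ' _ hev]

end Isomorphism

section Extremal

open Finset

variable {V : Type*} [Fintype V] {m q : ℕ}

lemma nonempty_iso_turanCircClique [DecidableEq V] {π : V → V} {col : V → Bool} (hm : 2 ≤ m)
    (hq : 1 ≤ q) {u : V} (hu : u ∈ coreClass π col true) (hπ : ∀ v, π v ≠ v → π v = u)
    (htrue : #(coreClass π col true) = m / 2) (hfalse : #(coreClass π col false) = (m + 1) / 2)
    (hcard : Fintype.card V = m + q - 1) :
    Nonempty (cliqueSuspension π col ≃g turanCircClique m q hm hq) := by
  rw [turanCircClique_eq_cliqueSuspension]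
  refine nonempty_iso_cliqueSuspension_of_card_eq (u' := .inl ⟨1, hm⟩) hu
    (mem_coreClass.2 ⟨by rfl, by rfl⟩) hπ ?_ (fun c ↦ ?_) ?_
  · rintro (x | w) hw
    exacts [absurd rfl hw, rfl]
  · cases c
    exacts [hfalse.trans (card_coreClass_turan_false hm hq).symm,
      htrue.trans (card_coreClass_turan_true hm hq).symm]
  · rw [hcard, card_sum_ne, Fintype.card_fin, Fintype.card_fin]

lemma specRad_le_and_nonempty_iso_of_eq {G : SimpleGraph V} (hm : 2 ≤ m) (hq : 1 ≤ q)
    (hqm : q ≤ m / 2) (hG : IsBipartiteSuspension (m + q - 1) (q + 1) G) :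
    specRad G ≤ specRad (turanCircClique m q hm hq) ∧
      (specRad G = specRad (turanCircClique m q hm hq) →
        Nonempty (G ≃g turanCircClique m q hm hq)) := by
  classical
  obtain ⟨t, hmt, ht, hspec⟩ := exists_specRad_turanCircClique_eq hm hq hqm
  obtain ⟨π, col, hπ, hle, hne, hcard, hcol⟩ := hG.exists_le_cliqueSuspension_card_le (by omega)
  obtain rfl : q = #{v | π v ≠ v} + 1 := by omega
  have hVcard := card_coreClass_add_card_coreClass π col
  rw [hG.1] at hVcard
  have hqt : (#{v | π v ≠ v} : ℝ) + 1 ≤ t := le_trans (by exact_mod_cast hqm) hmt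
  have hlt : (#{v | π v ≠ v} : ℝ) < t := by linarith
  have hx : ∀ v, (fiberExcess π v : ℝ) < t := fun v ↦
    (Nat.cast_le.2 (fiberExcess_le π v)).trans_lt hlt
  obtain ⟨hprod, heq⟩ := classWeight_mul_le_and_of_eq (m := m) hπ hqt (hne false) hcol (by omega)
  rw [Nat.add_sub_cancel] at ht
  rw [← ht] at hprod heq
  have ht₀ : 0 < t := (Nat.cast_nonneg _).trans_lt hlt
  rw [hspec]
  refine ⟨specRad_le_of_le_cliqueSuspension hπ ht₀ hx hne hprod hle, fun hs ↦ ?_⟩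
  obtain ⟨rfl, hprod_eq⟩ := eq_cliqueSuspension_of_specRad_eq hπ ht₀ hx hne hprod hle hs
  obtain ⟨hfalse, htrue | ⟨hbal, hgain⟩⟩ := heq hprod_eq
  · obtain ⟨u, hu, hroot⟩ := exists_forall_apply_eq_of_classGain_eq hπ hlt (hne true) htrue
    exact nonempty_iso_turanCircClique hm hq hu hroot (by omega) hfalse hG.1
  · obtain ⟨u, hu, hroot⟩ := exists_forall_apply_eq_of_classGain_eq hπ hlt (hne false) hgain
    rw [← cliqueSuspension_not]
    refine nonempty_iso_turanCircClique hm hq (u := u) ?_ hroot ?_ ?_ hG.1 <;>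
      rw [coreClass_not]
    exacts [hu, by simp only [Bool.not_true]; omega, by simp only [Bool.not_false]; omega]

end Extremal

end SpectralSuspension

open SpectralSuspension in
theorem mainTheorem6_general {n r m q : ℕ} (hm : 2 ≤ m) (hq : 1 ≤ q) (hn : m + q = n + 1)
    (hr : q + 1 = r) (hqm : q ≤ m / 2) :
    IsBipartiteSuspension n r (turanCircClique m q hm hq) ∧
    (∀ (V : Type*) [Fintype V] (G : SimpleGraph V), IsBipartiteSuspension n r G →
      specRad G ≤ specRad (turanCircClique m q hm hq) ∧
      (specRad G = specRad (turanCircClique m q hm hq) ↔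
        Nonempty (G ≃g turanCircClique m q hm hq))) ∧
    (∀ m' q' : ℕ, ∀ (hm' : 2 ≤ m') (hq' : 1 ≤ q'), m' + q' = n + 1 → q < q' → q' ≤ m' / 2 →
      specRad (turanCircClique m' q' hm' hq') < specRad (turanCircClique m q hm hq)) := by
  obtain rfl : n = m + q - 1 := by omega
  subst hr
  refine ⟨isBipartiteSuspension_turanCircClique hm hq, fun V _ G hG ↦ ?_,
    fun m' q' hm' hq' hsum ↦ specRad_turanCircClique_lt hm hq hm' hq' (by omega)⟩
  obtain ⟨hle, hiso⟩ := specRad_le_and_nonempty_iso_of_eq hm hq hqm hG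
  exact ⟨hle, hiso, fun ⟨e⟩ ↦ specRad_congr e⟩

open SpectralSuspension in
theorem mainTheorem6 (n k r : ℕ) (hn : 100 * k ≤ n) (hr : 3 ≤ r) (hrk : r ≤ 10 * k) :
    IsBipartiteSuspension n r
      (turanCircClique (n - r + 2) (r - 1) (by omega) (by omega)) ∧
    (∀ (V : Type*) [Fintype V] (G : SimpleGraph V), IsBipartiteSuspension n r G →
      specRad G ≤ specRad (turanCircClique (n - r + 2) (r - 1) (by omega) (by omega)) ∧
      (specRad G = specRad (turanCircClique (n - r + 2) (r - 1) (by omega) (by omega)) ↔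
        Nonempty (G ≃g turanCircClique (n - r + 2) (r - 1) (by omega) (by omega)))) ∧
    (∀ s : ℕ, ∀ hrs : r < s, s ≤ 10 * k →
      specRad (turanCircClique (n - s + 2) (s - 1) (by omega) (by omega)) <
        specRad (turanCircClique (n - r + 2) (r - 1) (by omega) (by omega))) := by
  obtain ⟨hmem, hmax, hlt⟩ := mainTheorem6_general (n := n) (r := r) (m := n - r + 2) (q := r - 1)
    (by omega) (by omega) (by omega) (by omega) (by omega)
  exact ⟨hmem, hmax, fun s hrs hs ↦ hlt _ _ _ _ (by omega) (by omega) (by omega)⟩
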